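/- Let $D\subset\mathbb{C}^n$ be a bounded homogeneous domain (a bounded connected open set on which the biholomorphic self-maps act transitively) containing the origin. Let $K$ be the Bergman kernel of $D$ and let $H_z(u,\bar v)=\frac12\sum_{j,k}\frac{\partial^2}{\partial z_j\,\partial\bar z_k}\log K(z,z)\,u_j\bar v_k$ be its Bergman metric. For holomorphic $f:D\to\mathbb{C}$ put $$\beta_f=\sup_{z\in D}\ \sup_{u\in\mathbb{C}^n\setminus\{0\}}\frac{\bigl|\sum_{k=1}^n\frac{\partial f}{\partial z_k}(z)\,u_k\bigr|}{H_z(u,\bar u)^{1/2}},$$ and let $\mathcal{B}(D)$ be the Bloch space of all holomorphic $f$ on $D$ with $\beta_f<\infty$, with norm $\|f\|_{\mathcal{B}}=|f(0)|+\beta_f$. Let $H^\infty(D)$ be the space of bounded holomorphic functions on $D$ with the supremum norm, and for $z\in D$ let $$\omega(z)=\sup\{|f(z)| : f\in\mathcal{B}(D),\ f(0)=0,\ \|f\|_{\mathcal{B}}\le 1\}.$$ Let $\psi$ be a holomorphic function on $D$ and $\varphi:D\to D$ a holomorphic self-map of $D$. If $\psi\in H^\infty(D)$ and $$\lim_{\varphi(z)\to\partial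 D}|\psi(z)|\,\omega(\varphi(z))=0$$ (that is, for every $\varepsilon>0$ there is $\delta>0$ such that $|\psi(z)|\,\omega(\varphi(z))<\varepsilon$ for all $z\in D$ with $\operatorname{dist}(\varphi(z),\partial D)<\delta$), then the weighted composition operator $W_{\psi,\varphi}f=\psi\,(f\circ\varphi)$ is a well-defined compact linear operator from $\mathcal{B}(D)$ to $H^\infty(D)$. -/

import Mathlib

open Filter Topology MeasureTheory
open scoped ENNReal ComplexConjugate BoundedContinuousFunction

namespace BlochHom

noncomputable section

/-- Extension by zero to all of `ℂⁿ` of a function given on the subset `D`. -/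
def extZero {n : ℕ} {D : Set (Fin n → ℂ)} {F : Type*} [Zero F] (f : D → F) :
    (Fin n → ℂ) → F :=
  Function.extend Subtype.val f 0

/-- A function on an open set `D ⊆ ℂⁿ` is holomorphic: it is complex differentiable at every point
of `D`. -/
def Holo {n : ℕ} {D : Set (Fin n → ℂ)} {F : Type*} [NormedAddCommGroup F] [NormedSpace ℂ F]
    (f : D → F) : Prop :=
  DifferentiableOn ℂ (extZero f) D

/-- A bounded homogeneous domain in `ℂⁿ` (containing the origin, which serves as base point):
a bounded connected open set on which the biholomorphic self-maps act transitively. -/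
structure BoundedHomogeneousDomain (n : ℕ) where
  carrier : Set (Fin n → ℂ)
  isOpen : IsOpen carrier
  isConnected : IsConnected carrier
  isBounded : Bornology.IsBounded carrier
  zero_mem : (0 : Fin n → ℂ) ∈ carrier
  homogeneous : ∀ z w : carrier, ∃ e : carrier ≃ carrier,
    Holo (fun x => (e x : Fin n → ℂ)) ∧ Holo (fun x => (e.symm x : Fin n → ℂ)) ∧ e z = w

/-! ### The Bergman kernel and the Bergman metric -/

/-- `K` is the Bergman kernel of `D` (on `D × D`): for each `w ∈ D` the function `K(·, w)` is
holomorphic and square integrable on `D` (with respect to Lebesgue measure), and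
`f(w) = ∫_D f(z) conj(K(z, w)) dV(z)` for all holomorphic square integrable `f` on `D`. -/
def IsBergmanKernel {n : ℕ} (D : Set (Fin n → ℂ)) (K : (Fin n → ℂ) → (Fin n → ℂ) → ℂ) : Prop :=
  ∀ w ∈ D,
    DifferentiableOn ℂ (fun z => K z w) D ∧
    MemLp (fun z => K z w) 2 (volume.restrict D) ∧
    ∀ f : (Fin n → ℂ) → ℂ, DifferentiableOn ℂ f D → MemLp f 2 (volume.restrict D) →
      f w = ∫ z in D, f z * conj (K z w)

/-- The Bergman kernel is unique. -/
theorem IsBergmanKernel.unique {n : ℕ} {D : Set (Fin n → ℂ)}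
    {K K' : (Fin n → ℂ) → (Fin n → ℂ) → ℂ}
    (h : IsBergmanKernel D K) (h' : IsBergmanKernel D K') {z w : Fin n → ℂ}
    (hz : z ∈ D) (hw : w ∈ D) : K z w = K' z w := by
  have key : ∀ {L M : (Fin n → ℂ) → (Fin n → ℂ) → ℂ}, IsBergmanKernel D L →
      IsBergmanKernel D M → L z w = conj (M w z) := by
    intro L M hL hM
    rw [(hM z hz).2.2 _ (hL w hw).1 (hL w hw).2.1, (hL w hw).2.2 _ (hM z hz).1 (hM z hz).2.1,
      ← integral_conj]
    simp [mul_comm]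
  rw [key h h', key h' h']

/-- The Bergman kernel `K(z, w)` of `D`. -/
def bergmanKernel {n : ℕ} (D : Set (Fin n → ℂ)) : (Fin n → ℂ) → (Fin n → ℂ) → ℂ :=
  Classical.epsilon (IsBergmanKernel D)

/-- The Wirtinger derivative `∂/∂z_j = (∂/∂x_j - i ∂/∂y_j) / 2`. -/
def dz {n : ℕ} (j : Fin n) (g : (Fin n → ℂ) → ℂ) (z : Fin n → ℂ) : ℂ :=
  (lineDeriv ℝ g z (Pi.single j 1) - Complex.I * lineDeriv ℝ g z (Pi.single j Complex.I)) / 2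

/-- The Wirtinger derivative `∂/∂z̄_j = (∂/∂x_j + i ∂/∂y_j) / 2`. -/
def dzbar {n : ℕ} (j : Fin n) (g : (Fin n → ℂ) → ℂ) (z : Fin n → ℂ) : ℂ :=
  (lineDeriv ℝ g z (Pi.single j 1) + Complex.I * lineDeriv ℝ g z (Pi.single j Complex.I)) / 2

/-- The function `z ↦ log K(z, z)`. -/
def logKernel {n : ℕ} (D : Set (Fin n → ℂ)) (z : Fin n → ℂ) : ℂ :=
  (Real.log (bergmanKernel D z z).re : ℂ)

/-- The Bergman metric `H_z(u, v̄) = ½ ∑ⱼₖ ∂²/∂zⱼ∂z̄ₖ log K(z, z) uⱼ v̄ₖ`, in the normalization for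
which `H_z(u, ū) = ∑ⱼ |uⱼ|² / (1 - |zⱼ|²)²` on the unit polydisk. -/
def bergmanMetric {n : ℕ} (D : Set (Fin n → ℂ)) (z u v : Fin n → ℂ) : ℂ :=
  (1 / 2) * ∑ j, ∑ k, dz j (dzbar k (logKernel D)) z * u j * conj (v k)

/-! ### The Bloch space -/

/-- `Q_f(z) = sup_{u ≠ 0} |(∇f)(z) u| / H_z(u, ū)^{1/2}`. -/
def blochQ {n : ℕ} (D : Set (Fin n → ℂ)) (f : D → ℂ) (z : Fin n → ℂ) : ℝ≥0∞ :=
  ⨆ (u : Fin n → ℂ) (_ : u ≠ 0),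
    ‖fderiv ℂ (extZero f) z u‖ₑ / ENNReal.ofReal (√(bergmanMetric D z u u).re)

/-- `β_f = sup_{z ∈ D} Q_f(z)`. -/
def blochBeta {n : ℕ} (D : Set (Fin n → ℂ)) (f : D → ℂ) : ℝ≥0∞ :=
  ⨆ z ∈ D, blochQ D f z

section aux

variable {n : ℕ} {D : Set (Fin n → ℂ)}

theorem extZero_apply {F : Type*} [Zero F] (f : D → F) (z : D) : extZero f z = f z :=
  Subtype.val_injective.extend_apply f 0 z

theorem extZero_add (f g : D → ℂ) : extZero (f + g) = extZero f + extZero g := by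
  ext z
  by_cases hz : z ∈ D
  · have := fun h : D → ℂ => extZero_apply h ⟨z, hz⟩
    simp_all
  · simp [extZero, hz]

theorem extZero_smul (c : ℂ) (f : D → ℂ) : extZero (c • f) = c • extZero f := by
  ext z
  by_cases hz : z ∈ D
  · have := fun h : D → ℂ => extZero_apply h ⟨z, hz⟩
    simp_all
  · simp [extZero, hz]

theorem extZero_zero : extZero (0 : D → ℂ) = 0 := by
  simpa using extZero_smul (0 : ℂ) (0 : D → ℂ)

theorem Holo.zero : Holo (0 : D → ℂ) := by
  unfold Holo
  rw [extZero_zero]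
  exact differentiableOn_const 0

theorem Holo.add {f g : D → ℂ} (hf : Holo f) (hg : Holo g) : Holo (f + g) := by
  unfold Holo
  rw [extZero_add]
  exact DifferentiableOn.add hf hg

theorem Holo.smul {f : D → ℂ} (c : ℂ) (hf : Holo f) : Holo (c • f) := by
  unfold Holo
  rw [extZero_smul]
  exact DifferentiableOn.const_smul hf c

theorem blochBeta_zero : blochBeta D 0 = 0 := by
  simp [blochBeta, blochQ, extZero_zero]

theorem blochBeta_add_le (hD : IsOpen D) {f g : D → ℂ} (hf : Holo f) (hg : Holo g) :
    blochBeta D (f + g) ≤ blochBeta D f + blochBeta D g := by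
  refine iSup₂_le fun z hz => iSup₂_le fun u hu => ?_
  have hfz := DifferentiableOn.differentiableAt hf (hD.mem_nhds hz)
  have hgz := DifferentiableOn.differentiableAt hg (hD.mem_nhds hz)
  rw [extZero_add, fderiv_add hfz hgz]
  calc _ ≤ (‖fderiv ℂ (extZero f) z u‖ₑ + ‖fderiv ℂ (extZero g) z u‖ₑ) /
        ENNReal.ofReal (√(bergmanMetric D z u u).re) := by
        gcongr
        exact enorm_add_le _ _
    _ ≤ _ := by
        rw [ENNReal.add_div]
        exact add_le_add
          (le_trans (le_iSup₂ (f := fun u (_ : u ≠ 0) => ‖fderiv ℂ (extZero f) z u‖ₑ /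
            ENNReal.ofReal (√(bergmanMetric D z u u).re)) u hu)
            (le_iSup₂ (f := fun z (_ : z ∈ D) => blochQ D f z) z hz))
          (le_trans (le_iSup₂ (f := fun u (_ : u ≠ 0) => ‖fderiv ℂ (extZero g) z u‖ₑ /
            ENNReal.ofReal (√(bergmanMetric D z u u).re)) u hu)
            (le_iSup₂ (f := fun z (_ : z ∈ D) => blochQ D g z) z hz))

theorem blochBeta_smul (c : ℂ) (f : D → ℂ) :
    blochBeta D (c • f) = ‖c‖ₑ * blochBeta D f := by
  simp only [blochBeta, blochQ, ENNReal.mul_iSup, extZero_smul, fderiv_const_smul_field,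
    Pi.smul_apply, _root_.smul_apply, enorm_smul, mul_div_assoc]

theorem eq_zero_of_blochBeta_eq_zero (hD : IsOpen D) (hc : IsPreconnected D) {f : D → ℂ}
    (hf : Holo f) (hb : blochBeta D f = 0) (z₀ : D) (h0 : f z₀ = 0) : f = 0 := by
  have hd : Set.EqOn (fderiv ℂ (extZero f)) 0 D := by
    intro z hz
    ext1 u
    by_cases hu : u = 0
    · simp [hu]
    · simp only [blochBeta, blochQ, ENNReal.iSup_eq_zero, ENNReal.div_eq_zero_iff] at hb
      simpa using hb z hz u hu
  funext z
  have := hD.is_const_of_fderiv_eq_zero hc hf hd z.2 z₀.2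
  rw [extZero_apply, extZero_apply] at this
  simp [this, h0]

end aux

variable {n : ℕ}

/-- The origin, as a point of the domain. -/
def BoundedHomogeneousDomain.base (D : BoundedHomogeneousDomain n) : D.carrier := ⟨0, D.zero_mem⟩

/-- The Bloch functions on `D`, as a linear subspace of all functions on `D`: the holomorphic `f`
with `β_f < ∞`. -/
def blochSubmodule (D : BoundedHomogeneousDomain n) : Submodule ℂ (D.carrier → ℂ) where
  carrier := {f | Holo f ∧ blochBeta D.carrier f < ∞}
  zero_mem' := ⟨Holo.zero, by rw [blochBeta_zero]; exact ENNReal.zero_lt_top⟩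
  add_mem' := fun hf hg => ⟨hf.1.add hg.1,
    (blochBeta_add_le D.isOpen hf.1 hg.1).trans_lt (ENNReal.add_lt_top.2 ⟨hf.2, hg.2⟩)⟩
  smul_mem' := fun c f hf => ⟨hf.1.smul c, by
    rw [blochBeta_smul]; exact ENNReal.mul_lt_top enorm_lt_top hf.2⟩

/-- The Bloch space `𝓑(D)`; its norm is `‖f‖ = |f(0)| + β_f`. -/
def BlochSpace (D : BoundedHomogeneousDomain n) : Type := blochSubmodule D

namespace BlochSpace

variable {D : BoundedHomogeneousDomain n}

instance : AddCommGroup (BlochSpace D) := inferInstanceAs (AddCommGroup (blochSubmodule D))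

instance : Module ℂ (BlochSpace D) := inferInstanceAs (Module ℂ (blochSubmodule D))

/-- A Bloch function, as a function on `D`. -/
def toFun (f : BlochSpace D) : D.carrier → ℂ := f.1

instance : CoeFun (BlochSpace D) (fun _ => D.carrier → ℂ) := ⟨toFun⟩

instance : Norm (BlochSpace D) := ⟨fun f => ‖f D.base‖ + (blochBeta D.carrier f).toReal⟩

theorem norm_def (f : BlochSpace D) : ‖f‖ = ‖f D.base‖ + (blochBeta D.carrier f).toReal := rfl

theorem normCore : NormedSpace.Core ℂ (BlochSpace D) where
  norm_nonneg f := add_nonneg (norm_nonneg _) ENNReal.toReal_nonneg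
  norm_smul c f := by
    have h : toFun (c • f) = c • toFun f := rfl
    simp only [norm_def, h, blochBeta_smul, ENNReal.toReal_mul, toReal_enorm, Pi.smul_apply,
      norm_smul]
    ring
  norm_triangle f g := by
    have h : toFun (f + g) = toFun f + toFun g := rfl
    simp only [norm_def, h, Pi.add_apply]
    have h1 := norm_add_le (f D.base) (g D.base)
    have h2 := ENNReal.toReal_mono (ENNReal.add_lt_top.2 ⟨f.2.2, g.2.2⟩).ne
      (blochBeta_add_le D.isOpen f.2.1 g.2.1)
    rw [ENNReal.toReal_add f.2.2.ne g.2.2.ne] at h2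
    change _ ≤ (blochBeta D.carrier (toFun f)).toReal + (blochBeta D.carrier (toFun g)).toReal at h2
    change (blochBeta D.carrier (toFun f + toFun g)).toReal ≤ _ at h2
    linarith
  norm_eq_zero_iff f := by
    constructor
    · intro h
      have h1 : 0 ≤ ‖f D.base‖ := norm_nonneg _
      have h2 : 0 ≤ (blochBeta D.carrier f).toReal := ENNReal.toReal_nonneg
      rw [norm_def] at h
      have hb : blochBeta D.carrier f = 0 := by
        have h3 : (blochBeta D.carrier f).toReal = 0 := by linarith
        exact ((ENNReal.toReal_eq_zero_iff _).1 h3).resolve_right f.2.2.ne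
      have h0 : f D.base = 0 := norm_eq_zero.1 (by linarith)
      exact Subtype.ext (eq_zero_of_blochBeta_eq_zero D.isOpen D.isConnected.isPreconnected
        f.2.1 hb D.base h0)
    · rintro rfl
      have h : toFun (0 : BlochSpace D) = 0 := rfl
      simp [norm_def, h, blochBeta_zero]

instance : NormedAddCommGroup (BlochSpace D) := NormedAddCommGroup.ofCore normCore

instance : NormedSpace ℂ (BlochSpace D) := NormedSpace.ofCore normCore

end BlochSpace

/-- `ω(z) = sup {|f(z)| : f ∈ 𝓑(D), f(0) = 0, ‖f‖ ≤ 1}`. -/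
def omega (D : BoundedHomogeneousDomain n) (z : D.carrier) : ℝ≥0∞ :=
  ⨆ (f : BlochSpace D) (_ : f D.base = 0 ∧ ‖f‖ ≤ 1), ‖f z‖ₑ

/-- `H^∞(D)`: the bounded holomorphic functions on `D`, with the supremum norm. -/
def HInfty (D : BoundedHomogeneousDomain n) : Submodule ℂ (D.carrier →ᵇ ℂ) where
  carrier := {f | Holo (f : D.carrier → ℂ)}
  zero_mem' := Holo.zero
  add_mem' := fun hf hg => Holo.add hf hg
  smul_mem' := fun c _ hf => Holo.smul c hf

end

end BlochHom

open Metric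

namespace BlochHom


/-! Let `B` bound `|ψ|` and let `ε > 0`. Near `∂D` the definition of `ω`, applied to a multiple of
`f - f(0)`, gives `|ψ(z)| |f(φ(z)) - f(0)| ≤ ε ‖f‖`. The values `φ(z)` away from `∂D` lie in a
compact `K ⊆ D`, which may be taken to contain `0`. Hence `|ψ(z) f(φ(z))| ≤ B sup_K |f| + ε ‖f‖` for
all `z` (`exists_isCompact_norm_mul_le`). With `ε = 1` this gives boundedness of the operator. Since
restriction to `K` maps the unit ball of the Bloch space to a totally bounded set
(`totallyBounded_restrictCompact`), letting `ε` shrink gives compactness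
(`isCompactOperator_of_forall_exists_totallyBounded`).

The total boundedness is Arzelà–Ascoli: `|df(u)| ≤ ‖f‖ H(u, u)^{1/2}`, so Bloch functions are
locally Lipschitz, uniformly on the unit ball, once `H` is locally bounded. For this `log K(z, z)`
has to be `C²`. The kernel is built from the Riesz representatives of the point evaluations on the
Bergman space. These evaluations depend holomorphically on the point in the dual norm, and `K(w, w)`
is the square of their norm, hence smooth; it is positive because constants are square integrable on
a bounded domain. -/

theorem exists_ball_bounded {E F : Type*} [PseudoMetricSpace E] [NormedAddCommGroup F] {f : E → F} {c : E}
    {U : Set E} (hU : IsOpen U) (hf : ContinuousOn f U) (hc : c ∈ U) :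
    ∃ r > 0, ball c r ⊆ U ∧ ∃ M, ∀ z ∈ ball c r, ‖f z‖ ≤ M := by
  have h1 : ∀ᶠ z in 𝓝 c, ‖f z‖ < ‖f c‖ + 1 :=
    (hf.continuousAt (hU.mem_nhds hc)).norm.eventually_lt_const (by linarith)
  obtain ⟨r, hr, h⟩ := Metric.eventually_nhds_iff_ball.1 (h1.and (hU.mem_nhds hc))
  exact ⟨r, hr, fun z hz => (h z hz).2, ‖f c‖ + 1, fun z hz => (h z hz).1.le⟩

/-! ### Cauchy estimates and holomorphic maps between normed spaces -/

section Holomorphic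

variable {E F : Type*} [NormedAddCommGroup E] [NormedSpace ℂ E] [NormedAddCommGroup F]
  [NormedSpace ℂ F] {f : E → F} {c : E} {r M : ℝ}

/-- Cauchy estimate for holomorphic maps between normed spaces. -/
theorem norm_fderiv_le_of_forall_ball (hr : 0 < r) (hf : DifferentiableOn ℂ f (ball c r))
    (hM : ∀ z ∈ ball c r, ‖f z‖ ≤ M) : ‖fderiv ℂ f c‖ ≤ 2 * M / r := by
  have hM0 : 0 ≤ M := (norm_nonneg _).trans (hM c (mem_ball_self hr))
  refine ContinuousLinearMap.opNorm_le_bound _ (by positivity) fun u => ?_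
  rcases eq_or_ne u 0 with rfl | hu
  · simp
  have hu' : 0 < ‖u‖ := norm_pos_iff.2 hu
  -- One-variable Cauchy on the slice `t ↦ f (c + t • u)`. Halving the radius keeps the closed disc
  -- inside the open ball and costs the factor 2.
  have hmem : ∀ t : ℂ, ‖t‖ ≤ r / 2 / ‖u‖ → c + t • u ∈ ball c r := by
    intro t ht
    rw [le_div_iff₀ hu'] at ht
    simp only [mem_ball, dist_self_add_left, norm_smul]
    linarith
  have hd : ∀ t : ℂ, ‖t‖ ≤ r / 2 / ‖u‖ →
      HasDerivAt (fun t : ℂ => f (c + t • u)) (fderiv ℂ f (c + t • u) u) t := by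
    intro t ht
    have h1 : HasFDerivAt f (fderiv ℂ f (c + t • u)) (c + t • u) :=
      (hf.differentiableAt (isOpen_ball.mem_nhds (hmem t ht))).hasFDerivAt
    have h2 : HasDerivAt (fun t : ℂ => c + t • u) u t := by
      simpa using ((hasDerivAt_id t).smul_const u).const_add c
    exact h1.comp_hasDerivAt t h2
  have hR : 0 < r / 2 / ‖u‖ := by positivity
  have key := Complex.norm_deriv_le_of_forall_mem_sphere_norm_le (c := 0) (C := M) hR
    (f := fun t : ℂ => f (c + t • u))
    (DifferentiableOn.diffContOnCl fun t ht => by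
      rw [closure_ball _ hR.ne', mem_closedBall_zero_iff] at ht
      exact (hd t ht).differentiableAt.differentiableWithinAt)
    (fun t ht => hM _ (hmem t (mem_sphere_zero_iff_norm.1 ht).le))
  rw [(hd 0 (by simpa using hR.le)).deriv] at key
  simp only [zero_smul, add_zero] at key
  calc _ ≤ _ := key
    _ = _ := by field_simp

/-- The Cauchy estimate on balls of radius `r / 2` bounds the derivative on the half ball, which is
convex, so the mean value inequality applies. -/
theorem norm_sub_le_of_forall_ball (hf : DifferentiableOn ℂ f (ball c r))
    (hM : ∀ z ∈ ball c r, ‖f z‖ ≤ M) {x y : E} (hx : x ∈ ball c (r / 2))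
    (hy : y ∈ ball c (r / 2)) : ‖f y - f x‖ ≤ 4 * M / r * ‖y - x‖ := by
  have hr : 0 < r := by linarith [pos_of_mem_ball hx]
  have hsub : ∀ z ∈ ball c (r / 2), ball z (r / 2) ⊆ ball c r := fun z hz =>
    ball_subset_ball' (by rw [mem_ball] at hz; linarith)
  refine (convex_ball c (r / 2)).norm_image_sub_le_of_norm_fderiv_le (𝕜 := ℂ) (fun z hz => ?_)
    (fun z hz => ?_) hx hy
  · exact hf.differentiableAt (isOpen_ball.mem_nhds (hsub z hz (mem_ball_self (by linarith))))
  · refine (norm_fderiv_le_of_forall_ball (half_pos hr) (hf.mono (hsub z hz))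
      fun w hw => hM w (hsub z hz hw)).trans (le_of_eq ?_)
    field_simp
    ring

/-- The translated difference `p ↦ f (p + (y - x)) - f p` is already of size `4 * M / r * ‖y - x‖`
near `x`; the Cauchy estimate on radius `r / 8` then bounds its derivative at `x`. -/
theorem norm_fderiv_sub_le_of_forall_ball (hf : DifferentiableOn ℂ f (ball c r))
    (hM : ∀ z ∈ ball c r, ‖f z‖ ≤ M) {x y : E} (hx : x ∈ ball c (r / 8))
    (hy : y ∈ ball c (r / 8)) :
    ‖fderiv ℂ f y - fderiv ℂ f x‖ ≤ 64 * M / r ^ 2 * ‖y - x‖ := by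
  have hr : 0 < r := by linarith [pos_of_mem_ball hx]
  have hxy : ‖y - x‖ < r / 4 := by
    rw [← dist_eq_norm]
    rw [mem_ball] at hx hy
    linarith [dist_triangle_right y x c]
  have h1 : ∀ p ∈ ball x (r / 8), p ∈ ball c (r / 2) ∧ p + (y - x) ∈ ball c (r / 2) := by
    intro p hp
    simp only [mem_ball] at *
    have h2 := dist_triangle p x c
    have h3 := dist_triangle (p + (y - x)) p c
    rw [dist_self_add_left] at h3
    constructor <;> linarith
  have hlt : r / 2 < r := by linarith
  have hda : ∀ p ∈ ball c (r / 2), DifferentiableAt ℂ f p := fun p hp =>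
    hf.differentiableAt (isOpen_ball.mem_nhds (ball_subset_ball hlt.le hp))
  have hd : ∀ p ∈ ball x (r / 8), HasFDerivAt (fun p => f (p + (y - x)) - f p)
      (fderiv ℂ f (p + (y - x)) - fderiv ℂ f p) p := fun p hp =>
    (hasFDerivAt_comp_add_right (y - x) |>.2 (hda _ (h1 p hp).2).hasFDerivAt).sub (hda _ (h1 p hp).1).hasFDerivAt
  have key := norm_fderiv_le_of_forall_ball (M := 4 * M / r * ‖y - x‖) (by linarith : 0 < r / 8)
    (fun p hp => (hd p hp).differentiableAt.differentiableWithinAt) fun p hp => by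
      simpa using norm_sub_le_of_forall_ball hf hM (h1 p hp).1 (h1 p hp).2
  rw [(hd x (mem_ball_self (by linarith))).fderiv, add_sub_cancel] at key
  refine key.trans (le_of_eq ?_)
  field_simp
  ring

/-- Quantitative first order Taylor formula for bounded holomorphic maps. -/
theorem norm_sub_sub_fderiv_le_of_forall_ball (hf : DifferentiableOn ℂ f (ball c r))
    (hM : ∀ z ∈ ball c r, ‖f z‖ ≤ M) {x y : E} (hx : x ∈ ball c (r / 8))
    (hy : y ∈ ball c (r / 8)) :
    ‖f y - f x - fderiv ℂ f x (y - x)‖ ≤ 64 * M / r ^ 2 * ‖y - x‖ ^ 2 := by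
  have hr : 0 < r := by linarith [pos_of_mem_ball hx]
  have hM0 : 0 ≤ M := (norm_nonneg _).trans (hM c (mem_ball_self hr))
  -- The intersection is convex, contains `x` and `y`, and all its points `p` satisfy `‖p - x‖ ≤ ‖y
  -- - x‖`, so one bound on the variation of the derivative serves throughout.
  have hconv : Convex ℝ (ball c (r / 8) ∩ closedBall x ‖y - x‖) :=
    (convex_ball _ _).inter (convex_closedBall _ _)
  rw [pow_two ‖y - x‖, ← mul_assoc]
  refine hconv.norm_image_sub_le_of_norm_fderiv_le' (𝕜 := ℂ) (fun p hp => ?_) (fun p hp => ?_)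
    ⟨hx, mem_closedBall_self (norm_nonneg _)⟩ ⟨hy, by simp [dist_eq_norm]⟩
  · exact hf.differentiableAt (isOpen_ball.mem_nhds (ball_subset_ball (by linarith) hp.1))
  · refine (norm_fderiv_sub_le_of_forall_ball hf hM hx hp.1).trans ?_
    have := hp.2
    rw [mem_closedBall, dist_eq_norm] at this
    gcongr

theorem hasFDerivAt_of_norm_sub_sub_le {L : E →L[ℂ] F} {C : ℝ} (hr : 0 < r)
    (h : ∀ y ∈ ball c r, ‖f y - f c - L (y - c)‖ ≤ C * ‖y - c‖ ^ 2) : HasFDerivAt f L c := by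
  refine HasFDerivAt.of_isLittleO ?_
  have h1 : (fun y => f y - f c - L (y - c)) =O[𝓝 c] fun y => ‖y - c‖ ^ 2 := by
    refine Asymptotics.IsBigO.of_bound C ?_
    filter_upwards [ball_mem_nhds c hr] with y hy
    simpa using h y hy
  refine (h1.trans_isLittleO ?_).trans_isBigO (Asymptotics.isBigO_refl _ _).norm_left
  have h2 : Tendsto (fun y => y - c) (𝓝 c) (𝓝 0) := by
    simpa using (tendsto_id (α := E) (x := 𝓝 c)).sub_const c
  simpa [Function.comp_def] using
    (Asymptotics.isLittleO_norm_pow_norm_pow (E' := E) one_lt_two).comp_tendsto h2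

/-- A uniform limit of holomorphic maps is holomorphic. -/
theorem differentiableAt_of_tendstoUniformlyOn_ball [CompleteSpace F] {ι : Type*} {l : Filter ι}
    [l.NeBot] {u : ι → E → F} (hr : 0 < r)
    (hu : ∀ᶠ i in l, DifferentiableOn ℂ (u i) (ball c r))
    (h : TendstoUniformlyOn u f l (ball c r)) : DifferentiableAt ℂ f c := by
  have hmem : ∀ x ∈ ball c (r / 2), ball x (r / 2) ⊆ ball c r := fun z hz =>
    ball_subset_ball' (by rw [mem_ball] at hz; linarith)
  have hself : ∀ x ∈ ball c (r / 2), x ∈ ball c r := fun x hx =>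
    hmem x hx (mem_ball_self (half_pos hr))
  have hc : UniformCauchySeqOn (fun i => fderiv ℂ (u i)) l (ball c (r / 2)) := by
    have h2 := h.uniformCauchySeqOn
    rw [SeminormedAddGroup.uniformCauchySeqOn_iff_tendstoUniformlyOn_zero,
      Metric.tendstoUniformlyOn_iff] at h2 ⊢
    intro ε hε
    -- The Cauchy estimate on radius `r / 2` turns `ε * r / 8` into `ε / 2`.
    filter_upwards [h2 (ε * r / 8) (by positivity), hu.prod_mk hu] with n hn hdn x hx
    have hda : ∀ i, DifferentiableOn ℂ (u i) (ball c r) → DifferentiableAt ℂ (u i) x :=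
      fun i hi => hi.differentiableAt (isOpen_ball.mem_nhds (hself x hx))
    have key := norm_fderiv_le_of_forall_ball (M := ε * r / 8) (half_pos hr)
      ((hdn.1.sub hdn.2).mono (hmem x hx)) fun z hz => by
        have := hn z (hmem x hx hz)
        rw [Pi.zero_apply, dist_zero_left, neg_add_eq_sub, norm_sub_rev] at this
        exact this.le
    rw [fderiv_sub (hda _ hdn.1) (hda _ hdn.2)] at key
    rw [Pi.zero_apply, dist_zero_left, neg_add_eq_sub, norm_sub_rev]
    refine key.trans_lt ?_
    field_simp
    norm_num
  have hlim : ∀ x ∈ ball c (r / 2), ∃ L, Tendsto (fun i => fderiv ℂ (u i) x) l (𝓝 L) :=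
    fun x hx => cauchy_map_iff_exists_tendsto.1 (hc.cauchy_map hx)
  choose! L hL using hlim
  have hloc := hc.tendstoUniformlyOn_of_tendsto hL
  refine (hasFDerivAt_of_tendstoUniformlyOnFilter (l := l) (f := u) (g' := L) (x := c)
    (hloc.tendstoUniformlyOnFilter.mono_right ?_) ?_ ?_).differentiableAt
  · exact le_principal_iff.2 (ball_mem_nhds c (half_pos hr))
  · refine (hu.prod_mk (ball_mem_nhds c hr)).mono fun p hp => ?_
    exact (hp.1.differentiableAt (isOpen_ball.mem_nhds hp.2)).hasFDerivAt
  · filter_upwards [ball_mem_nhds c hr] with y hy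
    exact h.tendsto_at hy


/-- Directional derivatives of holomorphic maps are holomorphic. -/
theorem DifferentiableOn.fderiv_apply [CompleteSpace F] {U : Set E} (hU : IsOpen U)
    (hf : DifferentiableOn ℂ f U) (v : E) : DifferentiableOn ℂ (fun z => fderiv ℂ f z v) U := by
  intro c hc
  obtain ⟨r, hr, hrU, M, hM⟩ := exists_ball_bounded hU hf.continuousOn hc
  have hM0 : 0 ≤ M := (norm_nonneg _).trans (hM c (mem_ball_self hr))
  replace hf := hf.mono hrU
  have hsmall : ∀ᶠ t : ℂ in 𝓝[≠] 0, ‖t • v‖ < r / 16 := by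
    have : Tendsto (fun t : ℂ => ‖t • v‖) (𝓝 0) (𝓝 ‖(0 : ℂ) • v‖) :=
      Continuous.tendsto (by fun_prop) 0
    exact (this.eventually_lt_const (by simpa using hr)).filter_mono nhdsWithin_le_nhds
  have hmem : ∀ t : ℂ, ‖t • v‖ < r / 16 → ∀ x ∈ ball c (r / 16), x + t • v ∈ ball c (r / 8) := by
    intro t ht x hx
    simp only [mem_ball] at *
    have := dist_triangle (x + t • v) x c
    rw [dist_self_add_left] at this
    linarith
  -- The directional derivative is the limit of difference quotients, which are holomorphic in `x`;
  -- the quadratic Taylor bound makes the convergence uniform near `c`.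
  refine (differentiableAt_of_tendstoUniformlyOn_ball (l := 𝓝[≠] (0 : ℂ))
    (u := fun t x => t⁻¹ • (f (x + t • v) - f x)) (r := r / 16) (by positivity) ?_
    ?_).differentiableWithinAt
  · filter_upwards [hsmall] with t ht
    have h1 : DifferentiableOn ℂ (fun x => f (x + t • v)) (ball c (r / 16)) :=
      hf.comp (by fun_prop) fun x hx => ball_subset_ball (by linarith) (hmem t ht x hx)
    exact (h1.sub (hf.mono (ball_subset_ball (by linarith)))).const_smul _
  · rw [Metric.tendstoUniformlyOn_iff]
    intro ε hε
    have hlim : Tendsto (fun t : ℂ => 64 * M / r ^ 2 * ‖v‖ ^ 2 * ‖t‖) (𝓝 0)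
        (𝓝 (64 * M / r ^ 2 * ‖v‖ ^ 2 * ‖(0 : ℂ)‖)) := Continuous.tendsto (by fun_prop) 0
    filter_upwards [hsmall, self_mem_nhdsWithin,
      (hlim.eventually_lt_const (u := ε) (by simpa using hε)).filter_mono nhdsWithin_le_nhds]
      with t ht ht0 hte x hx
    have ht0' : t ≠ 0 := ht0
    have key := norm_sub_sub_fderiv_le_of_forall_ball hf hM
      (ball_subset_ball (by linarith) hx) (hmem t ht x hx)
    rw [add_sub_cancel_left, map_smul, norm_smul t v] at key
    refine lt_of_le_of_lt ?_ hte
    have hpos : 0 < ‖t‖ := norm_pos_iff.2 ht0'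
    rw [dist_comm, dist_eq_norm]
    have h3 : t⁻¹ • (f (x + t • v) - f x) - fderiv ℂ f x v =
        t⁻¹ • (f (x + t • v) - f x - t • fderiv ℂ f x v) := by
      rw [smul_sub t⁻¹ _ (t • _), inv_smul_smul₀ ht0']
    rw [h3, norm_smul, norm_inv, inv_mul_le_iff₀ hpos]
    exact key.trans (le_of_eq (by ring))

/-- Holomorphic maps on open subsets of a finite-dimensional space are smooth. -/
theorem DifferentiableOn.contDiffOn_of_finiteDimensional [FiniteDimensional ℂ E] [CompleteSpace F]
    {U : Set E} (hU : IsOpen U) (k : ℕ) (hf : DifferentiableOn ℂ f U) : ContDiffOn ℂ k f U := by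
  induction k generalizing f with
  | zero => exact contDiffOn_zero.2 hf.continuousOn
  | succ k ih =>
    rw [Nat.cast_add, Nat.cast_one, contDiffOn_succ_iff_fderiv_of_isOpen hU]
    exact ⟨hf, by simp, contDiffOn_clm_apply.2 fun v => ih (DifferentiableOn.fderiv_apply hU hf v)⟩

/-- Weakly-* holomorphic families of functionals on a Banach space are holomorphic in norm. -/
theorem differentiableOn_of_forall_apply [FiniteDimensional ℂ E] {X : Type*}
    [NormedAddCommGroup X] [NormedSpace ℂ X] [CompleteSpace X] {U : Set E} (hU : IsOpen U)
    {Φ : E → X →L[ℂ] ℂ} (hΦ : ∀ x, DifferentiableOn ℂ (fun w => Φ w x) U) :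
    DifferentiableOn ℂ Φ U := by
  intro c hc
  have := FiniteDimensional.proper ℂ E
  obtain ⟨r, hr, hrU⟩ := Metric.nhds_basis_closedBall.mem_iff.1 (hU.mem_nhds hc)
  -- Uniform boundedness makes all the Cauchy and Taylor constants below proportional to `‖x‖`. So
  -- the pointwise derivatives assemble into a bounded operator `B`, and the Taylor remainder is
  -- controlled in operator norm.
  obtain ⟨M, hM⟩ : ∃ M, ∀ w : closedBall c r, ‖Φ w‖ ≤ M := by
    refine banach_steinhaus fun x => ?_
    obtain ⟨C, hC⟩ := (isCompact_closedBall c r).exists_bound_of_continuousOn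
      ((hΦ x).continuousOn.mono hrU)
    exact ⟨C, fun w => hC w w.2⟩
  have hd : ∀ x, DifferentiableOn ℂ (fun w => Φ w x) (ball c r) := fun x =>
    (hΦ x).mono (ball_subset_closedBall.trans hrU)
  have hb : ∀ x, ∀ w ∈ ball c r, ‖Φ w x‖ ≤ M * ‖x‖ := fun x w hw =>
    (Φ w).le_of_opNorm_le (hM ⟨w, ball_subset_closedBall hw⟩) x
  have hM0 : 0 ≤ M := (norm_nonneg _).trans (hM ⟨c, mem_closedBall_self hr.le⟩)
  have hda : ∀ x, DifferentiableAt ℂ (fun w => Φ w x) c := fun x =>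
    (hd x).differentiableAt (ball_mem_nhds c hr)
  let A : E →ₗ[ℂ] X →ₗ[ℂ] ℂ := LinearMap.mk₂ ℂ (fun h x => fderiv ℂ (fun w => Φ w x) c h)
    (fun _ _ _ => map_add _ _ _) (fun _ _ _ => map_smul _ _ _)
    (fun h x y => by
      simp only [map_add]
      rw [fderiv_fun_add (hda x) (hda y)]
      rfl)
    (fun a h x => by
      simp only [map_smul]
      rw [fderiv_fun_const_smul (hda x)]
      rfl)
  let B : E →L[ℂ] X →L[ℂ] ℂ := A.mkContinuous₂ (2 * M / r) fun h x => by
    have h1 := norm_fderiv_le_of_forall_ball hr (hd x) (hb x)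
    refine ((fderiv ℂ (fun w => Φ w x) c).le_of_opNorm_le h1 h).trans (le_of_eq ?_)
    ring
  have hB : HasFDerivAt Φ B c := by
    refine hasFDerivAt_of_norm_sub_sub_le (r := r / 8) (C := 64 * M / r ^ 2) (by positivity)
      fun y hy => ContinuousLinearMap.opNorm_le_bound _ (by positivity) fun x => ?_
    refine (norm_sub_sub_fderiv_le_of_forall_ball (hd x) (hb x)
      (mem_ball_self (by positivity)) hy).trans (le_of_eq ?_)
    ring
  exact hB.differentiableAt.differentiableWithinAt

end Holomorphic


/-! ### The mean value property on polydisks -/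

section MeanValue

variable {n : ℕ}

theorem measurePreserving_smul_of_norm_eq_one {a : ℂ} (ha : ‖a‖ = 1) :
    MeasurePreserving (fun x : Fin n → ℂ => a • x) := by
  let e : ℂ ≃ₗᵢ[ℝ] ℂ := rotation ⟨a, mem_sphere_zero_iff_norm.2 ha⟩
  have h : MeasurePreserving (fun z : ℂ => a * z) := e.measurePreserving
  exact volume_preserving_pi (fun _ : Fin n => h)

/-- Mean value property of holomorphic functions on balls for the supremum norm (polydisks). -/
theorem setIntegral_closedBall_eq {f : (Fin n → ℂ) → ℂ} {w : Fin n → ℂ} {r : ℝ}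
    {U : Set (Fin n → ℂ)} (hf : DifferentiableOn ℂ f U)
    (hsub : closedBall w r ⊆ U) :
    ∫ z in closedBall w r, f z = volume.real (closedBall w r) • f w := by
  set B : Set (Fin n → ℂ) := closedBall 0 r with hB
  have hmem : ∀ θ : ℝ, ∀ x ∈ B, w + Complex.exp (θ * Complex.I) • x ∈ U := by
    intro θ x hx
    refine hsub ?_
    rw [hB, mem_closedBall_zero_iff] at hx
    simpa [norm_smul, Complex.norm_exp_ofReal_mul_I] using hx
  have htrans : ∫ z in closedBall w r, f z = ∫ x in B, f (w + x) := by
    have h := (measurePreserving_add_left (volume : Measure (Fin n → ℂ)) w).setIntegral_preimage_emb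
      (measurableEmbedding_addLeft w) f (closedBall w r)
    rw [← h, preimage_add_closedBall, sub_self]
  -- Rotation by `exp (iθ)` preserves the polydisk and its volume. Averaging over `θ` and exchanging
  -- integrals thus reduces the claim to the circle mean value property along each complex line
  -- through `w`.
  have hrot : ∀ θ : ℝ, ∫ x in B, f (w + Complex.exp (θ * Complex.I) • x) =
      ∫ x in B, f (w + x) := by
    intro θ
    have ha := Complex.norm_exp_ofReal_mul_I θ
    have ha0 : Complex.exp (θ * Complex.I) ≠ 0 := Complex.exp_ne_zero _
    have h := (measurePreserving_smul_of_norm_eq_one (n := n) ha).setIntegral_preimage_emb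
      (measurableEmbedding_const_smul₀ ha0) (fun x => f (w + x)) B
    have hpre : (fun x : Fin n → ℂ => Complex.exp (θ * Complex.I) • x) ⁻¹' B = B := by
      ext x
      simp [hB, norm_smul, ha]
    rw [hpre] at h
    exact h
  have hmv : ∀ x ∈ B, ∫ θ in (0)..(2 * Real.pi), f (w + Complex.exp (θ * Complex.I) • x) =
      (2 * Real.pi) • f w := by
    intro x hx
    have h1 : DifferentiableOn ℂ (fun t : ℂ => f (w + t • x)) (closedBall 0 1) := by
      refine hf.comp (by fun_prop) fun t ht => hsub ?_
      rw [hB, mem_closedBall_zero_iff] at hx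
      rw [mem_closedBall_zero_iff] at ht
      simp only [mem_closedBall, dist_self_add_left, norm_smul]
      nlinarith [norm_nonneg x]
    have h2 := DiffContOnCl.circleAverage (f := fun t : ℂ => f (w + t • x)) (c := 0) (R := 1)
      (DifferentiableOn.diffContOnCl (by
        rw [abs_one, closure_ball _ one_ne_zero]
        exact h1))
    rw [Real.circleAverage_def, inv_smul_eq_iff₀ (by positivity)] at h2
    simpa [circleMap] using h2
  have hcont : ContinuousOn (fun p : ℝ × (Fin n → ℂ) => f (w + Complex.exp (p.1 * Complex.I) • p.2))
      (Set.Icc 0 (2 * Real.pi) ×ˢ B) :=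
    hf.continuousOn.comp (by fun_prop) fun p hp => hmem p.1 p.2 hp.2
  have hint : Integrable (fun p : ℝ × (Fin n → ℂ) => f (w + Complex.exp (p.1 * Complex.I) • p.2))
      ((volume.restrict (Set.Ioc 0 (2 * Real.pi))).prod (volume.restrict B)) := by
    rw [Measure.prod_restrict]
    exact (hcont.integrableOn_compact (isCompact_Icc.prod (isCompact_closedBall _ _))).mono_set
      (Set.prod_mono Set.Ioc_subset_Icc_self subset_rfl)
  have hswap := integral_integral_swap
    (f := fun (θ : ℝ) (x : Fin n → ℂ) => f (w + Complex.exp (θ * Complex.I) • x)) hint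
  have h2pi : (0 : ℝ) ≤ 2 * Real.pi := by positivity
  simp_rw [hrot, ← intervalIntegral.integral_of_le h2pi] at hswap
  rw [setIntegral_congr_fun (isClosed_closedBall.measurableSet) hmv,
    intervalIntegral.integral_const, sub_zero, setIntegral_const, smul_comm] at hswap
  rw [htrans, smul_right_injective ℂ (by positivity : (2 * Real.pi) ≠ 0) hswap, Measure.real,
    Measure.real, Measure.addHaar_closedBall_center volume w]

end MeanValue

/-! ### The Bergman space and smoothness of its kernel on the diagonal -/

section BergmanSpace

/-- The Riesz isometry moves the question to `H`, where the squared norm is smooth. It is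
conjugate-linear, so it is used as a real-linear map. -/
theorem contDiffOn_norm_sq_strongDual {E H : Type*} [NormedAddCommGroup E] [NormedSpace ℂ E]
    [NormedAddCommGroup H] [InnerProductSpace ℂ H] [CompleteSpace H] {U : Set E}
    {Φ : E → StrongDual ℂ H} {k : WithTop ℕ∞} (hΦ : ContDiffOn ℂ k Φ U) :
    ContDiffOn ℝ k (fun w => ‖Φ w‖ ^ 2) U := by
  let J := (InnerProductSpace.toDual ℂ H).symm
  let J' : StrongDual ℂ H →ₗ[ℝ] H :=
    { toFun := J
      map_add' := map_add J
      map_smul' := fun c L => by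
        have h : c • L = (c : ℂ) • L := by ext; simp
        rw [h, LinearIsometryEquiv.map_smulₛₗ, Complex.conj_ofReal, RingHom.id_apply,
          Complex.coe_smul] }
  have hJ' : ∀ L, ‖J' L‖ = ‖L‖ := fun L => J.norm_map L
  have h1 : ContDiffOn ℝ k Φ U := hΦ.restrict_scalars ℝ
  have h2 : ContDiffOn ℝ k (fun w => J'.mkContinuous 1 (fun L => by rw [hJ', one_mul]) (Φ w)) U :=
    (ContinuousLinearMap.contDiff _).comp_contDiffOn h1
  refine (h2.norm_sq ℂ).congr fun w _ => ?_
  rw [LinearMap.mkContinuous_apply, hJ']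

variable {n : ℕ} {D : Set (Fin n → ℂ)}

/-- Point evaluations of holomorphic functions are bounded in `L²`, uniformly on points at a fixed
distance from the complement of the domain. -/
theorem exists_norm_le_mul_norm_Lp (D : Set (Fin n → ℂ)) {r : ℝ} (hr : 0 < r) :
    ∃ C : ℝ, 0 ≤ C ∧ ∀ w, closedBall w r ⊆ D → ∀ f, DifferentiableOn ℂ f D →
      ∀ F : Lp ℂ 2 (volume.restrict D), F =ᵐ[volume.restrict D] f → ‖f w‖ ≤ C * ‖F‖ := by
  set V : ℝ := volume.real (closedBall (0 : Fin n → ℂ) r) with hV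
  have hVw : ∀ w : Fin n → ℂ, volume.real (closedBall w r) = V := fun w => by
    rw [hV, Measure.real, Measure.real, Measure.addHaar_closedBall_center volume w]
  have hV0 : 0 < V := ENNReal.toReal_pos (measure_closedBall_pos _ _ hr).ne'
    measure_closedBall_lt_top.ne
  refine ⟨V⁻¹ * V ^ (1 / (2 : ℝ)), by positivity, fun w hw f hf F hF => ?_⟩
  have hm : MeasurableSet (closedBall w r) := isClosed_closedBall.measurableSet
  have hres : (volume.restrict D).restrict (closedBall w r) = volume.restrict (closedBall w r) := by
    rw [Measure.restrict_restrict hm, Set.inter_eq_left.2 hw]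
  have hfin : (volume.restrict D) (closedBall w r) ≠ ∞ :=
    ((Measure.restrict_apply_le _ _).trans_lt measure_closedBall_lt_top).ne
  -- By the mean value property, pairing `F` with the indicator of the ball gives its volume times
  -- `f w`; Cauchy–Schwarz finishes.
  have h1 := L2.inner_indicatorConstLp_one (𝕜 := ℂ) hm hfin F
  rw [integral_congr_ae (ae_restrict_of_ae hF), hres, setIntegral_closedBall_eq hf hw,
    hVw] at h1
  have h2 := norm_inner_le_norm (𝕜 := ℂ) (indicatorConstLp 2 hm hfin (1 : ℂ)) F
  rw [h1, norm_smul, norm_indicatorConstLp two_ne_zero ENNReal.ofNat_ne_top,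
    measureReal_restrict_apply hm, Set.inter_eq_left.2 hw, hVw, Real.norm_of_nonneg hV0.le,
    norm_one, one_mul] at h2
  rw [mul_assoc, ← div_eq_inv_mul, le_div_iff₀ hV0, mul_comm]
  simpa using h2

/-- The Bergman space `A²(D)` of square integrable holomorphic functions. -/
def bergmanSpace (D : Set (Fin n → ℂ)) : Submodule ℂ (Lp ℂ 2 (volume.restrict D)) where
  carrier := {F | ∃ f, DifferentiableOn ℂ f D ∧ F =ᵐ[volume.restrict D] f}
  zero_mem' := ⟨0, differentiableOn_const 0, Lp.coeFn_zero _ _ _⟩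
  add_mem' := by
    rintro F G ⟨f, hf, hF⟩ ⟨g, hg, hG⟩
    exact ⟨f + g, hf.add hg, (Lp.coeFn_add F G).trans (hF.add hG)⟩
  smul_mem' := by
    rintro c F ⟨f, hf, hF⟩
    exact ⟨c • f, hf.const_smul c, (Lp.coeFn_smul c F).trans (hF.const_smul c)⟩

theorem exists_closedBall_bound (hD : IsOpen D) {w : Fin n → ℂ} (hw : w ∈ D) :
    ∃ r > 0, ball w r ⊆ D ∧ ∃ C : ℝ, 0 ≤ C ∧ ∀ z ∈ ball w r, ∀ f, DifferentiableOn ℂ f D →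
      ∀ F : Lp ℂ 2 (volume.restrict D), F =ᵐ[volume.restrict D] f → ‖f z‖ ≤ C * ‖F‖ := by
  obtain ⟨r, hr, hrD⟩ := Metric.nhds_basis_closedBall.mem_iff.1 (hD.mem_nhds hw)
  obtain ⟨C, hC0, hC⟩ := exists_norm_le_mul_norm_Lp D (half_pos hr)
  refine ⟨r / 2, half_pos hr, (ball_subset_closedBall.trans
    (closedBall_subset_closedBall (by linarith))).trans hrD, C, hC0, fun z hz => hC z ?_⟩
  exact (closedBall_subset_closedBall' (by rw [mem_ball] at hz; linarith)).trans hrD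

/-- The difference represents `0` in `L²`, so the evaluation bound makes it vanish at every point.
-/
theorem eqOn_of_ae_eq (hD : IsOpen D) {f g : (Fin n → ℂ) → ℂ} (hf : DifferentiableOn ℂ f D)
    (hg : DifferentiableOn ℂ g D) {F : Lp ℂ 2 (volume.restrict D)}
    (hF : F =ᵐ[volume.restrict D] f) (hG : F =ᵐ[volume.restrict D] g) : Set.EqOn f g D := by
  intro w hw
  obtain ⟨r, hr, -, C, -, hC⟩ := exists_closedBall_bound hD hw
  have := hC w (mem_ball_self hr) (f - g) (hf.sub hg) 0 (by
    filter_upwards [Lp.coeFn_zero ℂ 2 (volume.restrict D), hF, hG] with x h1 h2 h3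
    simpa [← h2, ← h3] using h1)
  simpa [sub_eq_zero] using this

/-- Evaluation bounds turn `L²` convergence into locally uniform convergence of the representatives,
so their limit is holomorphic; an a.e. convergent subsequence identifies it with the `L²` limit. -/
theorem isClosed_bergmanSpace (hD : IsOpen D) :
    IsClosed (bergmanSpace D : Set (Lp ℂ 2 (volume.restrict D))) := by
  refine IsSeqClosed.isClosed fun F G hF hFG => ?_
  choose f hf hFf using hF
  have hcauchy : ∀ w ∈ D, ∃ r > 0, ball w r ⊆ D ∧ UniformCauchySeqOn f atTop (ball w r) := by
    intro w hw
    obtain ⟨r, hr, hrD, C, hC0, hC⟩ := exists_closedBall_bound hD hw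
    refine ⟨r, hr, hrD, Metric.uniformCauchySeqOn_iff.2 fun ε hε => ?_⟩
    obtain ⟨N, hN⟩ := Metric.cauchySeq_iff.1 hFG.cauchySeq (ε / (C + 1)) (by positivity)
    refine ⟨N, fun k hk l hl x hx => ?_⟩
    have h1 := hC x hx (f k - f l) ((hf k).sub (hf l)) (F k - F l)
      ((Lp.coeFn_sub _ _).trans ((hFf k).sub (hFf l)))
    have h2 := hN k hk l hl
    rw [dist_eq_norm, lt_div_iff₀ (by positivity)] at h2
    rw [dist_eq_norm]
    refine lt_of_le_of_lt h1 ?_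
    nlinarith [norm_nonneg (F k - F l)]
  have hlim : ∀ w ∈ D, ∃ a, Tendsto (fun k => f k w) atTop (𝓝 a) := by
    intro w hw
    obtain ⟨r, hr, -, h⟩ := hcauchy w hw
    exact cauchy_map_iff_exists_tendsto.1 (h.cauchy_map (mem_ball_self hr))
  choose! g hg using hlim
  refine ⟨g, fun w hw => ?_, ?_⟩
  · obtain ⟨r, hr, hrD, h⟩ := hcauchy w hw
    exact (differentiableAt_of_tendstoUniformlyOn_ball hr
      (Eventually.of_forall fun k => (hf k).mono hrD)
      (h.tendstoUniformlyOn_of_tendsto fun x hx => hg x (hrD hx))).differentiableWithinAt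
  · obtain ⟨s, hs, hae⟩ := (tendstoInMeasure_of_tendsto_Lp hFG).exists_seq_tendsto_ae
    have hall : ∀ᵐ x ∂(volume.restrict D), ∀ k, F k x = f k x := ae_all_iff.2 hFf
    filter_upwards [hae, hall, ae_restrict_mem hD.measurableSet] with x h1 h2 hx
    simp_rw [h2] at h1
    exact tendsto_nhds_unique h1 ((hg x hx).comp hs.tendsto_atTop)

/-- The holomorphic representative of an element of the Bergman space. -/
noncomputable def bergmanRep (F : bergmanSpace D) : (Fin n → ℂ) → ℂ := F.2.choose

theorem differentiableOn_bergmanRep (F : bergmanSpace D) :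
    DifferentiableOn ℂ (bergmanRep F) D := F.2.choose_spec.1

theorem ae_eq_bergmanRep (F : bergmanSpace D) :
    (F : Lp ℂ 2 (volume.restrict D)) =ᵐ[volume.restrict D] bergmanRep F := F.2.choose_spec.2

theorem bergmanRep_eq (hD : IsOpen D) (F : bergmanSpace D) {f : (Fin n → ℂ) → ℂ}
    (hf : DifferentiableOn ℂ f D) (hF : (F : Lp ℂ 2 (volume.restrict D)) =ᵐ[volume.restrict D] f)
    {w : Fin n → ℂ} (hw : w ∈ D) : bergmanRep F w = f w :=
  eqOn_of_ae_eq hD (differentiableOn_bergmanRep F) hf (ae_eq_bergmanRep F) hF hw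

/-- Point evaluations on the Bergman space. -/
theorem exists_bergmanEval (hD : IsOpen D) :
    ∃ Φ : (Fin n → ℂ) → bergmanSpace D →L[ℂ] ℂ, ∀ w ∈ D, ∀ F, Φ w F = bergmanRep F w := by
  have h : ∀ w ∈ D, ∃ L : bergmanSpace D →L[ℂ] ℂ, ∀ F, L F = bergmanRep F w := by
    intro w hw
    obtain ⟨r, hr, -, C, -, hC⟩ := exists_closedBall_bound hD hw
    let L : bergmanSpace D →ₗ[ℂ] ℂ :=
      { toFun := fun F => bergmanRep F w
        map_add' := fun F G => bergmanRep_eq hD _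
          ((differentiableOn_bergmanRep F).add (differentiableOn_bergmanRep G))
          ((Lp.coeFn_add _ _).trans ((ae_eq_bergmanRep F).add (ae_eq_bergmanRep G))) hw
        map_smul' := fun c F => bergmanRep_eq hD _
          ((differentiableOn_bergmanRep F).const_smul c)
          ((Lp.coeFn_smul _ _).trans ((ae_eq_bergmanRep F).const_smul c)) hw }
    exact ⟨L.mkContinuous C fun F => hC w (mem_ball_self hr) _ (differentiableOn_bergmanRep F) F
      (ae_eq_bergmanRep F), fun F => rfl⟩
  choose! Φ hΦ using h
  exact ⟨Φ, hΦ⟩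

/-- The Bergman kernel exists and is twice continuously differentiable on the diagonal. -/
theorem exists_isBergmanKernel (hD : IsOpen D) :
    ∃ K, IsBergmanKernel D K ∧ ContDiffOn ℝ 2 (fun z => (K z z).re) D := by
  have : CompleteSpace (bergmanSpace D) := (isClosed_bergmanSpace hD).completeSpace_coe
  obtain ⟨Φ, hΦ⟩ := exists_bergmanEval hD
  let J := (InnerProductSpace.toDual ℂ (bergmanSpace D)).symm
  have hJ : ∀ w F, inner ℂ (J (Φ w)) F = Φ w F := fun w F =>
    InnerProductSpace.toDual_symm_apply
  refine ⟨fun z w => bergmanRep (J (Φ w)) z, fun w hw => ⟨differentiableOn_bergmanRep _,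
    (memLp_congr_ae (ae_eq_bergmanRep _)).1 (Lp.memLp _), fun f hf hf2 => ?_⟩, ?_⟩
  · have hFf := hf2.coeFn_toLp
    let F : bergmanSpace D := ⟨hf2.toLp f, f, hf, hFf⟩
    rw [← bergmanRep_eq hD F hf hFf hw, ← hΦ w hw, ← hJ, Submodule.coe_inner, L2.inner_def]
    refine integral_congr_ae ?_
    filter_upwards [hFf, ae_eq_bergmanRep (J (Φ w))] with x h1 h2
    simp [F, h1, h2]
  · have hΦd : ContDiffOn ℂ 2 Φ D := by
      refine DifferentiableOn.contDiffOn_of_finiteDimensional hD 2 ?_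
      exact differentiableOn_of_forall_apply hD fun F =>
        (differentiableOn_bergmanRep F).congr fun w hw => hΦ w hw F
    refine (contDiffOn_norm_sq_strongDual hΦd).congr fun w hw => ?_
    -- Evaluating the Riesz representative at its own point: `K(w, w)` is the squared norm of the
    -- evaluation functional.
    have h1 : ((‖J (Φ w)‖ : ℂ) ^ 2) = bergmanRep (J (Φ w)) w := by
      rw [← hΦ w hw, ← hJ]
      exact (inner_self_eq_norm_sq_to_K _).symm
    rw [LinearIsometryEquiv.norm_map] at h1
    simp only [← h1]
    norm_cast

theorem isBergmanKernel_bergmanKernel (hD : IsOpen D) : IsBergmanKernel D (bergmanKernel D) :=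
  Classical.epsilon_spec ((exists_isBergmanKernel hD).imp fun _ h => h.1)

/-- `K(w, w)` is the squared `L²` norm of `K(·, w)`. If it were zero, reproducing the constant `1`,
which is square integrable on a bounded set, would give `1 = 0`. -/
theorem bergmanKernel_self_pos (hD : IsOpen D) (hb : Bornology.IsBounded D) {w : Fin n → ℂ}
    (hw : w ∈ D) : 0 < (bergmanKernel D w w).re := by
  have hK := isBergmanKernel_bergmanKernel hD w hw
  have h1 := hK.2.2 _ hK.1 hK.2.1
  have hnorm : ∀ z, bergmanKernel D z w * conj (bergmanKernel D z w) =
      ((‖bergmanKernel D z w‖ ^ 2 : ℝ) : ℂ) := fun z => by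
    rw [Complex.mul_conj, Complex.normSq_eq_norm_sq]
  simp_rw [hnorm, integral_complex_ofReal] at h1
  rw [h1, Complex.ofReal_re]
  refine (integral_nonneg fun z => by positivity).lt_of_ne fun h0 => ?_
  have hint : Integrable (fun z => ‖bergmanKernel D z w‖ ^ 2) (volume.restrict D) :=
    (memLp_two_iff_integrable_sq_norm hK.2.1.1).1 hK.2.1
  rw [eq_comm, integral_eq_zero_iff_of_nonneg (fun z => by positivity) hint] at h0
  have : IsFiniteMeasure (volume.restrict D) := ⟨by
    simpa using hb.measure_lt_top⟩
  have h2 := hK.2.2 (fun _ => 1) (differentiableOn_const 1) (memLp_const 1)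
  rw [integral_eq_zero_of_ae] at h2
  · exact one_ne_zero h2
  · filter_upwards [h0] with z hz
    simpa using hz

/-- Uniqueness of the kernel carries smoothness from the constructed kernel to the chosen one. -/
theorem contDiffOn_logKernel (hD : IsOpen D) (hb : Bornology.IsBounded D) :
    ContDiffOn ℝ 2 (logKernel D) D := by
  obtain ⟨K, hK, hKd⟩ := exists_isBergmanKernel hD
  have h1 : ContDiffOn ℝ 2 (fun z => (bergmanKernel D z z).re) D := hKd.congr fun z hz => by
    rw [(isBergmanKernel_bergmanKernel hD).unique hK hz hz]
  exact Complex.ofRealCLM.contDiff.comp_contDiffOn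
    (h1.log fun z hz => (bergmanKernel_self_pos hD hb hz).ne')

end BergmanSpace


/-! ### Local boundedness of the Bergman metric -/

section BergmanMetric

variable {n : ℕ} {D : Set (Fin n → ℂ)}

theorem ContDiffOn.lineDeriv_of_isOpen {k : WithTop ℕ∞} {g : (Fin n → ℂ) → ℂ} (hD : IsOpen D)
    (hg : ContDiffOn ℝ (k + 1) g D) (v : Fin n → ℂ) :
    ContDiffOn ℝ k (fun z => lineDeriv ℝ g z v) D := by
  refine (((contDiffOn_succ_iff_fderiv_of_isOpen hD).1 hg).2.2.clm_apply
    (contDiffOn_const (c := v))).congr fun z hz => ?_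
  exact ((hg.differentiableOn (by simp)).differentiableAt (hD.mem_nhds hz)).lineDeriv_eq_fderiv

theorem ContDiffOn.dz {k : WithTop ℕ∞} {g : (Fin n → ℂ) → ℂ} (hD : IsOpen D)
    (hg : ContDiffOn ℝ (k + 1) g D) (j : Fin n) : ContDiffOn ℝ k (dz j g) D :=
  ((ContDiffOn.lineDeriv_of_isOpen hD hg _).sub
    (contDiffOn_const.mul (ContDiffOn.lineDeriv_of_isOpen hD hg _))).div_const 2

theorem ContDiffOn.dzbar {k : WithTop ℕ∞} {g : (Fin n → ℂ) → ℂ} (hD : IsOpen D)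
    (hg : ContDiffOn ℝ (k + 1) g D) (j : Fin n) : ContDiffOn ℝ k (dzbar j g) D :=
  ((ContDiffOn.lineDeriv_of_isOpen hD hg _).add
    (contDiffOn_const.mul (ContDiffOn.lineDeriv_of_isOpen hD hg _))).div_const 2

theorem continuousOn_dz_dzbar_logKernel (hD : IsOpen D) (hb : Bornology.IsBounded D)
    (j k : Fin n) : ContinuousOn (dz j (dzbar k (logKernel D))) D := by
  have h := contDiffOn_logKernel hD hb
  rw [← one_add_one_eq_two] at h
  have h1 := ContDiffOn.dzbar hD h k
  rw [← zero_add 1] at h1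
  exact (ContDiffOn.dz hD h1 j).continuousOn

/-- The Bergman metric is locally bounded by the Euclidean one. -/
theorem exists_sqrt_bergmanMetric_le (hD : IsOpen D) (hb : Bornology.IsBounded D)
    {z : Fin n → ℂ} (hz : z ∈ D) : ∃ C : ℝ, 0 ≤ C ∧
      ∀ᶠ w in 𝓝 z, ∀ u, √(bergmanMetric D w u u).re ≤ C * ‖u‖ := by
  set S : (Fin n → ℂ) → ℝ := fun w => ∑ j, ∑ k, ‖dz j (dzbar k (logKernel D)) w‖ with hS
  have hcont : ContinuousAt S z := by
    refine ContinuousOn.continuousAt ?_ (hD.mem_nhds hz)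
    exact continuousOn_finsetSum _ fun j _ => continuousOn_finsetSum _ fun k _ =>
      (continuousOn_dz_dzbar_logKernel hD hb j k).norm
  refine ⟨√(S z + 1), Real.sqrt_nonneg _, ?_⟩
  filter_upwards [hcont.eventually_lt_const (lt_add_one (S z))] with w hw u
  have h1 : (bergmanMetric D w u u).re ≤ S w * ‖u‖ ^ 2 := by
    refine (Complex.re_le_norm _).trans ?_
    rw [bergmanMetric, norm_mul, hS, Finset.sum_mul]
    refine (mul_le_of_le_one_left (norm_nonneg _) (by norm_num)).trans ?_
    refine (norm_sum_le _ _).trans (Finset.sum_le_sum fun j _ => ?_)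
    rw [Finset.sum_mul]
    refine (norm_sum_le _ _).trans (Finset.sum_le_sum fun k _ => ?_)
    rw [norm_mul, norm_mul, RCLike.norm_conj, mul_assoc, pow_two]
    gcongr
    · exact norm_le_pi_norm u j
    · exact norm_le_pi_norm u k
  rw [← Real.sqrt_sq (norm_nonneg u), ← Real.sqrt_mul' _ (by positivity)]
  refine Real.sqrt_le_sqrt (h1.trans ?_)
  gcongr

end BergmanMetric

/-! ### Elementary properties of holomorphic functions given on a subset -/

theorem Holo.continuous {n : ℕ} {D : Set (Fin n → ℂ)} {F : Type*} [NormedAddCommGroup F]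
    [NormedSpace ℂ F] {f : D → F} (hf : Holo f) : Continuous f := by
  have h := continuousOn_iff_continuous_domRestrict.1 (DifferentiableOn.continuousOn hf)
  exact h.congr fun z => extZero_apply f z

theorem Holo.const {n : ℕ} {D : Set (Fin n → ℂ)} (c : ℂ) : Holo (fun _ : D => c) :=
  (differentiableOn_const c).congr fun z hz => extZero_apply (fun _ : D => c) ⟨z, hz⟩

theorem Holo.mul_comp {n : ℕ} {D : Set (Fin n → ℂ)} {ψ f : D → ℂ} {φ : D → D} (hψ : Holo ψ)
    (hf : Holo f) (hφ : Holo (fun z => (φ z : Fin n → ℂ))) : Holo (fun z => ψ z * f (φ z)) := by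
  have hφD : ∀ z (hz : z ∈ D), extZero (fun z => (φ z : Fin n → ℂ)) z = φ ⟨z, hz⟩ :=
    fun z hz => extZero_apply _ ⟨z, hz⟩
  refine (DifferentiableOn.mul hψ (DifferentiableOn.comp (t := D) hf hφ fun z hz => ?_)).congr
    fun z hz => ?_
  · rw [hφD z hz]
    exact (φ ⟨z, hz⟩).2
  · have h1 := extZero_apply (fun z => ψ z * f (φ z)) ⟨z, hz⟩
    have h2 := extZero_apply ψ ⟨z, hz⟩
    have h3 := extZero_apply f (φ ⟨z, hz⟩)
    rw [Pi.mul_apply, Function.comp_apply, hφD z hz, h3]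
    exact h1.trans (by rw [← h2])

theorem blochBeta_const {n : ℕ} {D : Set (Fin n → ℂ)} (hD : IsOpen D) (c : ℂ) :
    blochBeta D (fun _ => c) = 0 := by
  simp only [blochBeta, blochQ, ENNReal.iSup_eq_zero]
  intro z hz u _
  have h : extZero (fun _ : D => c) =ᶠ[𝓝 z] fun _ => c := by
    filter_upwards [hD.mem_nhds hz] with w hw
    exact extZero_apply (fun _ : D => c) ⟨w, hw⟩
  rw [h.fderiv_eq]
  simp

/-! ### Bloch functions: Lipschitz bounds, point evaluations, Montel's theorem -/

namespace BlochSpace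

variable {n : ℕ} {D : BoundedHomogeneousDomain n}

theorem toFun_sub_apply (f g : BlochSpace D) (z : D.carrier) : (f - g) z = f z - g z := rfl

theorem toReal_blochBeta_le_norm (f : BlochSpace D) : (blochBeta D.carrier f).toReal ≤ ‖f‖ := by
  rw [norm_def]
  linarith [norm_nonneg (f D.base)]

theorem norm_base_le (f : BlochSpace D) : ‖f D.base‖ ≤ ‖f‖ := by
  rw [norm_def]
  linarith [ENNReal.toReal_nonneg (a := blochBeta D.carrier f)]

theorem norm_fderiv_apply_le (f : BlochSpace D) {z : Fin n → ℂ} (hz : z ∈ D.carrier)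
    (u : Fin n → ℂ) :
    ‖fderiv ℂ (extZero f) z u‖ ≤ ‖f‖ * √(bergmanMetric D.carrier z u u).re := by
  rcases eq_or_ne u 0 with rfl | hu
  · simp only [map_zero, norm_zero]
    positivity
  have hfin : blochBeta D.carrier f ≠ ∞ := f.2.2.ne
  have h1 : ‖fderiv ℂ (extZero f) z u‖ₑ / ENNReal.ofReal (√(bergmanMetric D.carrier z u u).re) ≤
      blochBeta D.carrier f :=
    (le_iSup₂ (f := fun u (_ : u ≠ 0) => ‖fderiv ℂ (extZero f) z u‖ₑ /
      ENNReal.ofReal (√(bergmanMetric D.carrier z u u).re)) u hu).trans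
      (le_iSup₂ (f := fun z (_ : z ∈ D.carrier) => blochQ D.carrier f z) z hz)
  -- No nondegeneracy of the metric is needed: a quotient by `0` is `∞` unless its numerator
  -- vanishes, and `β_f` is finite.
  rw [ENNReal.div_le_iff_le_mul (Or.inr hfin) (Or.inl ENNReal.ofReal_ne_top)] at h1
  have h2 := ENNReal.toReal_mono (ENNReal.mul_ne_top hfin ENNReal.ofReal_ne_top) h1
  rw [toReal_enorm, ENNReal.toReal_mul, ENNReal.toReal_ofReal (Real.sqrt_nonneg _)] at h2
  exact h2.trans (mul_le_mul_of_nonneg_right (toReal_blochBeta_le_norm f) (Real.sqrt_nonneg _))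

/-- Bloch functions are locally Lipschitz, uniformly on the unit ball of the Bloch space. -/
theorem exists_ball_norm_sub_le {z : Fin n → ℂ} (hz : z ∈ D.carrier) :
    ∃ r > 0, ball z r ⊆ D.carrier ∧ ∃ C : ℝ, 0 ≤ C ∧ ∀ x ∈ ball z r, ∀ y ∈ ball z r,
      ∀ f : BlochSpace D, ‖extZero f y - extZero f x‖ ≤ C * ‖f‖ * ‖y - x‖ := by
  obtain ⟨C, hC0, hC⟩ := exists_sqrt_bergmanMetric_le D.isOpen D.isBounded hz
  obtain ⟨r, hr, h⟩ := Metric.eventually_nhds_iff_ball.1 (hC.and (D.isOpen.mem_nhds hz))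
  refine ⟨r, hr, fun w hw => (h w hw).2, C, hC0, fun x hx y hy f => ?_⟩
  refine (convex_ball z r).norm_image_sub_le_of_norm_fderiv_le (𝕜 := ℂ) (fun w hw => ?_)
    (fun w hw => ?_) hx hy
  · exact DifferentiableOn.differentiableAt f.2.1 (D.isOpen.mem_nhds (h w hw).2)
  · refine ContinuousLinearMap.opNorm_le_bound _ (by positivity) fun u => ?_
    refine (norm_fderiv_apply_le f (h w hw).2 u).trans ?_
    calc _ ≤ ‖f‖ * (C * ‖u‖) := by gcongr; exact (h w hw).1 u
      _ = _ := by ring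

/-- Point evaluations on the Bloch space are bounded. -/
theorem exists_norm_apply_le {z : Fin n → ℂ} (hz : z ∈ D.carrier) :
    ∃ C : ℝ, ∀ f : BlochSpace D, ‖extZero f z‖ ≤ C * ‖f‖ := by
  have step : ∀ x y : Fin n → ℂ, ∀ C : ℝ,
      (∀ f : BlochSpace D, ‖extZero f y - extZero f x‖ ≤ C * ‖f‖ * ‖y - x‖) →
      (∃ C : ℝ, ∀ f : BlochSpace D, ‖extZero f x‖ ≤ C * ‖f‖) →
      ∃ C : ℝ, ∀ f : BlochSpace D, ‖extZero f y‖ ≤ C * ‖f‖ := by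
    rintro x y C h ⟨C', hC'⟩
    refine ⟨C * ‖y - x‖ + C', fun f => ?_⟩
    have h1 := norm_sub_norm_le (extZero f y) (extZero f x)
    nlinarith [h f, hC' f]
  -- Connectedness argument: the local Lipschitz bound carries an evaluation bound between nearby
  -- points, so `S` is open and relatively closed in the domain, and it contains the origin.
  let S : Set (Fin n → ℂ) :=
    {z | z ∈ D.carrier ∧ ∃ C : ℝ, ∀ f : BlochSpace D, ‖extZero f z‖ ≤ C * ‖f‖}
  have hS : IsOpen S := by
    rw [isOpen_iff_mem_nhds]
    rintro x ⟨hx, hxC⟩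
    obtain ⟨r, hr, hrD, C, -, hC⟩ := exists_ball_norm_sub_le hx
    filter_upwards [ball_mem_nhds x hr] with y hy
    exact ⟨hrD hy, step x y C (hC x (mem_ball_self hr) y hy) hxC⟩
  have hsub : D.carrier ⊆ S := by
    refine D.isConnected.isPreconnected.subset_of_closure_inter_subset hS
      ⟨0, D.zero_mem, D.zero_mem, 1, fun f => ?_⟩ ?_
    · have h1 := extZero_apply f D.base
      rw [one_mul]
      exact (congrArg norm h1).trans_le (norm_base_le f)
    · rintro y ⟨hyS, hy⟩
      obtain ⟨r, hr, hrD, C, -, hC⟩ := exists_ball_norm_sub_le hy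
      obtain ⟨x, hx, hxS⟩ := mem_closure_iff_nhds.1 hyS _ (ball_mem_nhds y hr)
      exact ⟨hy, step x y C (hC x hx y (mem_ball_self hr)) hxS.2⟩
  exact (hsub hz).2

/-- The evaluation bound at one point and the local Lipschitz bound give a uniform bound on a ball;
finitely many balls cover `K`. -/
theorem exists_norm_apply_le_of_isCompact {K : Set (Fin n → ℂ)} (hK : IsCompact K)
    (hKD : K ⊆ D.carrier) :
    ∃ C : ℝ, 0 ≤ C ∧ ∀ z ∈ K, ∀ f : BlochSpace D, ‖extZero f z‖ ≤ C * ‖f‖ := by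
  refine hK.induction_on (p := fun K => ∃ C : ℝ, 0 ≤ C ∧ ∀ z ∈ K, ∀ f : BlochSpace D,
    ‖extZero f z‖ ≤ C * ‖f‖) ⟨0, le_rfl, by simp⟩ ?_ ?_ ?_
  · rintro s t hst ⟨C, hC0, hC⟩
    exact ⟨C, hC0, fun z hz => hC z (hst hz)⟩
  · rintro s t ⟨C, hC0, hC⟩ ⟨C', hC0', hC'⟩
    refine ⟨max C C', le_max_of_le_left hC0, fun z hz f => ?_⟩
    rcases hz with hz | hz
    · exact (hC z hz f).trans (by gcongr; exact le_max_left _ _)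
    · exact (hC' z hz f).trans (by gcongr; exact le_max_right _ _)
  · intro z hz
    obtain ⟨r, hr, hrD, C, hC0, hC⟩ := exists_ball_norm_sub_le (hKD hz)
    obtain ⟨C', hC'⟩ := exists_norm_apply_le (hKD hz)
    refine ⟨ball z r, mem_nhdsWithin_of_mem_nhds (ball_mem_nhds z hr), C * r + max C' 0,
      by positivity, fun y hy f => ?_⟩
    have h1 := hC z (mem_ball_self hr) y hy f
    have h2 := norm_sub_norm_le (extZero f y) (extZero f z)
    rw [mem_ball, dist_eq_norm] at hy
    have h3 : C * ‖f‖ * ‖y - z‖ ≤ C * ‖f‖ * r := by gcongr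
    have h4 : C' * ‖f‖ ≤ max C' 0 * ‖f‖ := by gcongr; exact le_max_left _ _
    linarith [hC' f]

/-- The Bloch function `f - f(0)`. -/
def subBase (f : BlochSpace D) : BlochSpace D :=
  ⟨toFun f + fun _ => -f D.base, f.2.1.add (Holo.const _),
    (blochBeta_add_le D.isOpen f.2.1 (Holo.const _)).trans_lt (by
      rw [blochBeta_const D.isOpen, add_zero]
      exact f.2.2)⟩

theorem subBase_apply (f : BlochSpace D) (z : D.carrier) : f.subBase z = f z - f D.base :=
  (sub_eq_add_neg _ _).symm

theorem norm_subBase_le (f : BlochSpace D) : ‖f.subBase‖ ≤ ‖f‖ := by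
  rw [norm_def f.subBase, subBase_apply, sub_self, norm_zero, zero_add]
  refine le_trans ?_ (toReal_blochBeta_le_norm f)
  refine ENNReal.toReal_mono f.2.2.ne ?_
  refine (blochBeta_add_le D.isOpen f.2.1 (Holo.const _)).trans ?_
  rw [blochBeta_const D.isOpen, add_zero]
  exact le_rfl

/-- Dividing `f - f(0)` by `‖f‖` gives a competitor in the supremum defining `ω`, since removing the
constant does not increase the norm. -/
theorem mul_norm_sub_base_le {ε : ℝ} {a : ℂ} {z : D.carrier}
    (h : ‖a‖ₑ * omega D z < ENNReal.ofReal ε) (f : BlochSpace D) :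
    ‖a‖ * ‖f z - f D.base‖ ≤ ε * ‖f‖ := by
  rcases eq_or_ne f 0 with rfl | hf
  · have h0 : ∀ w : D.carrier, (0 : BlochSpace D) w = 0 := fun _ => rfl
    simp [h0]
  have hf' : 0 < ‖f‖ := norm_pos_iff.2 hf
  let g : BlochSpace D := ((‖f‖⁻¹ : ℝ) : ℂ) • f.subBase
  have hg : ∀ w, g w = ((‖f‖⁻¹ : ℝ) : ℂ) * (f w - f D.base) := fun w => by
    rw [← subBase_apply]
    rfl
  have hg1 : ‖g‖ ≤ 1 := by
    rw [norm_smul, Complex.norm_real, Real.norm_of_nonneg (by positivity), inv_mul_le_iff₀ hf',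
      mul_one]
    exact norm_subBase_le f
  have h1 : ‖g z‖ₑ ≤ omega D z :=
    le_iSup₂ (f := fun (f : BlochSpace D) (_ : f D.base = 0 ∧ ‖f‖ ≤ 1) => ‖f z‖ₑ) g
      ⟨by rw [hg, sub_self, mul_zero], hg1⟩
  have h2 : ‖a * g z‖ₑ < ENNReal.ofReal ε := by
    rw [enorm_mul]
    exact (mul_le_mul_right h1 _).trans_lt h
  rw [← ofReal_norm, ENNReal.ofReal_lt_ofReal_iff_of_nonneg (norm_nonneg _), norm_mul, hg,
    norm_mul, Complex.norm_real, Real.norm_of_nonneg (by positivity)] at h2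
  have h3 : ‖a‖ * ‖f z - f D.base‖ = ‖a‖ * (‖f‖⁻¹ * ‖f z - f D.base‖) * ‖f‖ := by field_simp
  rw [h3]
  gcongr

/-- Restriction of Bloch functions to a compact subset of the domain. -/
noncomputable def restrictCompact {K : Set (Fin n → ℂ)} [CompactSpace K] (hKD : K ⊆ D.carrier)
    (f : BlochSpace D) : K →ᵇ ℂ :=
  BoundedContinuousFunction.mkOfCompact
    ⟨fun z => f ⟨z, hKD z.2⟩, f.2.1.continuous.comp (by fun_prop)⟩

/-- Montel's theorem for the unit ball of the Bloch space. -/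
theorem totallyBounded_restrictCompact {K : Set (Fin n → ℂ)} [CompactSpace K]
    (hKD : K ⊆ D.carrier) :
    TotallyBounded (restrictCompact hKD '' closedBall (0 : BlochSpace D) 1) := by
  obtain ⟨C, hC0, hC⟩ := exists_norm_apply_le_of_isCompact (isCompact_iff_compactSpace.2 ‹_›) hKD
  have hval : ∀ (f : BlochSpace D) (z : K), restrictCompact hKD f z = extZero f z := fun f z =>
    (extZero_apply f ⟨z, hKD z.2⟩).symm
  refine (BoundedContinuousFunction.arzela_ascoli (closedBall 0 C) (isCompact_closedBall 0 C) _ ?_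
    ?_).totallyBounded.subset subset_closure
  · rintro _ z ⟨f, hf, rfl⟩
    rw [mem_closedBall_zero_iff] at hf ⊢
    rw [hval]
    refine (hC z z.2 f).trans ?_
    nlinarith
  · intro z
    rw [Metric.equicontinuousAt_iff]
    intro ε hε
    obtain ⟨r, hr, -, L, hL0, hL⟩ := exists_ball_norm_sub_le (hKD z.2)
    refine ⟨min r (ε / (L + 1)), by positivity, ?_⟩
    rintro y hy ⟨_, f, hf, rfl⟩
    rw [mem_closedBall_zero_iff] at hf
    rw [lt_min_iff, Subtype.dist_eq, lt_div_iff₀ (by positivity)] at hy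
    have h1 := hL z (mem_ball_self hr) y hy.1 f
    change dist (restrictCompact hKD f z) (restrictCompact hKD f y) < ε
    rw [hval, hval, dist_comm, dist_eq_norm]
    rw [dist_eq_norm] at hy
    have h2 : L * ‖f‖ * ‖(y : Fin n → ℂ) - z‖ ≤ L * 1 * ‖(y : Fin n → ℂ) - z‖ := by gcongr
    nlinarith [norm_nonneg ((y : Fin n → ℂ) - z)]

end BlochSpace

/-! ### Compactness of the weighted composition operator -/

theorem isClosed_HInfty {n : ℕ} (D : BoundedHomogeneousDomain n) :
    IsClosed (HInfty D : Set (D.carrier →ᵇ ℂ)) := by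
  refine IsSeqClosed.isClosed fun F G hF hFG => ?_
  intro w hw
  obtain ⟨r, hr, hrD⟩ := Metric.isOpen_iff.1 D.isOpen w hw
  have hU := BoundedContinuousFunction.tendsto_iff_tendstoUniformly.1 hFG
  refine (differentiableAt_of_tendstoUniformlyOn_ball (u := fun k => extZero (F k)) (l := atTop) hr
    (Eventually.of_forall fun k => DifferentiableOn.mono (hF k) hrD) ?_).differentiableWithinAt
  rw [Metric.tendstoUniformlyOn_iff]
  intro ε hε
  filter_upwards [Metric.tendstoUniformly_iff.1 hU ε hε] with k hk z hz
  have h1 := extZero_apply (F k) ⟨z, hrD hz⟩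
  have h2 := extZero_apply G ⟨z, hrD hz⟩
  rw [h1, h2]
  exact hk _

/-- If `|ψ| ω(φ) → 0` as `φ → ∂D`, then `f ↦ ψ (f ∘ φ)` is controlled by the restriction of `f` to a
compact subset of `D`, up to an arbitrarily small multiple of the Bloch norm. -/
theorem exists_isCompact_norm_mul_le {n : ℕ} {D : BoundedHomogeneousDomain n}
    {ψ : D.carrier → ℂ} {φ : D.carrier → D.carrier} {B : ℝ} (hB : ∀ z, ‖ψ z‖ ≤ B)
    (hlim : Tendsto (fun z => ‖ψ z‖ₑ * omega D (φ z))
      (comap (fun z => (φ z : Fin n → ℂ)) (𝓝ˢ (frontier D.carrier))) (𝓝 0))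
    {ε : ℝ} (hε : 0 < ε) :
    ∃ K : Set (Fin n → ℂ), IsCompact K ∧ ∃ hKD : K ⊆ D.carrier, ∀ (f : BlochSpace D) (M : ℝ),
      (∀ w (hw : w ∈ K), ‖f ⟨w, hKD hw⟩‖ ≤ M) → ∀ z, ‖ψ z * f (φ z)‖ ≤ B * M + ε * ‖f‖ := by
  obtain ⟨V, hV, hVε⟩ := (hlim.eventually_lt_const (ENNReal.ofReal_pos.2 hε) :
    ∀ᶠ z in _, ‖ψ z‖ₑ * omega D (φ z) < ENNReal.ofReal ε)
  obtain ⟨O, hO, hfO, hOV⟩ := mem_nhdsSet_iff_exists.1 hV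
  -- Removing a neighbourhood of the frontier from the closure leaves a compact subset of the
  -- domain. The origin is added so that `M` also bounds `f(0)`.
  have hKD : insert 0 (closure D.carrier \ O) ⊆ D.carrier := by
    refine Set.insert_subset D.zero_mem fun w hw => ?_
    by_contra hwD
    refine hw.2 (hfO ⟨hw.1, fun hwi => hwD (interior_subset hwi)⟩)
  refine ⟨insert 0 (closure D.carrier \ O), (D.isBounded.isCompact_closure.diff hO).insert 0, hKD,
    fun f M hM z => ?_⟩
  have hB0 : 0 ≤ B := (norm_nonneg _).trans (hB z)
  rw [norm_mul]
  by_cases hz : (φ z : Fin n → ℂ) ∈ O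
  · have h1 := BlochSpace.mul_norm_sub_base_le (hVε (hOV hz)) f
    have h2 : ‖f D.base‖ ≤ M := hM 0 (Set.mem_insert _ _)
    have h3 : ‖f (φ z)‖ ≤ ‖f (φ z) - f D.base‖ + ‖f D.base‖ := by
      simpa using norm_add_le (f (φ z) - f D.base) (f D.base)
    calc _ ≤ ‖ψ z‖ * (‖f (φ z) - f D.base‖ + ‖f D.base‖) := by gcongr
      _ = ‖ψ z‖ * ‖f (φ z) - f D.base‖ + ‖ψ z‖ * ‖f D.base‖ := mul_add _ _ _
      _ ≤ ε * ‖f‖ + B * M := by gcongr; exact hB z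
      _ = _ := add_comm _ _
  · have h2 : ‖f (φ z)‖ ≤ M := hM (φ z) (Set.mem_insert_of_mem _ ⟨subset_closure (φ z).2, hz⟩)
    have h3 : 0 ≤ ε * ‖f‖ := by positivity
    have h4 : ‖ψ z‖ * ‖f (φ z)‖ ≤ B * M := by gcongr; exact hB z
    linarith

/-- A linear map which is controlled, up to small multiples of the norm, by maps sending the unit
ball to totally bounded sets, is compact. -/
theorem isCompactOperator_of_forall_exists_totallyBounded {X Y : Type*} [NormedAddCommGroup X]
    [NormedSpace ℂ X] [NormedAddCommGroup Y] [NormedSpace ℂ Y] [CompleteSpace Y] (T : X →L[ℂ] Y)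
    (h : ∀ ε > 0, ∃ (Z : Type) (_ : PseudoMetricSpace Z) (R : X → Z) (B : ℝ),
      0 ≤ B ∧ TotallyBounded (R '' closedBall 0 1) ∧
      ∀ f g, ‖T (f - g)‖ ≤ B * dist (R f) (R g) + ε * ‖f - g‖) : IsCompactOperator T := by
  refine (isCompactOperator_iff_isCompact_closure_image_closedBall (T : X →ₗ[ℂ] Y) one_pos).2 ?_
  refine (TotallyBounded.closure ?_).isCompact_of_isClosed isClosed_closure
  rw [Metric.totallyBounded_iff]
  intro ε hε
  -- On the unit ball `‖f - g‖ ≤ 2`, so each of the two error terms is at most `ε / 4`; the `+ 1` in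
  -- the mesh of the net allows `B = 0`.
  obtain ⟨Z, _, R, B, hB0, hR, hT⟩ := h (ε / 8) (by positivity)
  obtain ⟨t, htR, htf, ht⟩ := totallyBounded_iff_subset.1 hR _
    (Metric.dist_mem_uniformity (by positivity : 0 < ε / (4 * (B + 1))))
  -- The centres of the net lie in the image of the ball, so they lift to finitely many elements of
  -- the ball, whose images under `T` form the required net.
  obtain ⟨s, hs, hsf, rfl⟩ := Set.exists_subset_image_finite_and.1 ⟨t, htR, htf, rfl⟩
  refine ⟨T '' s, hsf.image T, ?_⟩
  rintro _ ⟨f, hf, rfl⟩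
  obtain ⟨_, ⟨g, hg, rfl⟩, hfg⟩ := Set.mem_iUnion₂.1 (ht ⟨f, hf, rfl⟩)
  refine Set.mem_iUnion₂.2 ⟨T g, ⟨g, hg, rfl⟩, ?_⟩
  change dist (R f) (R g) < _ at hfg
  have hgs := hs hg
  rw [mem_closedBall_zero_iff] at hf hgs
  have h1 := norm_sub_le f g
  have h2 := hT f g
  change dist (T f) (T g) < ε
  rw [dist_eq_norm, ← map_sub]
  rw [lt_div_iff₀ (by positivity)] at hfg
  nlinarith [dist_nonneg (x := R f) (y := R g)]

end BlochHom

theorem theorem7p5 {n : ℕ} (D : BlochHom.BoundedHomogeneousDomain n)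
    (ψ : D.carrier → ℂ) (hψ : BlochHom.Holo ψ)
    (φ : D.carrier → D.carrier) (hφ : BlochHom.Holo (fun z => (φ z : Fin n → ℂ)))
    (hψ_bdd : ∃ C : ℝ, ∀ z, ‖ψ z‖ ≤ C)
    (hlim : Tendsto (fun z => ‖ψ z‖ₑ * BlochHom.omega D (φ z))
      (comap (fun z => (φ z : Fin n → ℂ)) (𝓝ˢ (frontier D.carrier))) (𝓝 0)) :
    ∃ W : BlochHom.BlochSpace D →L[ℂ] BlochHom.HInfty D,
      (∀ (f : BlochHom.BlochSpace D) (z : D.carrier),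
        (W f : D.carrier →ᵇ ℂ) z = ψ z * f (φ z)) ∧
      IsCompactOperator W := by
  obtain ⟨B, hB⟩ := hψ_bdd
  have hB0 : 0 ≤ B := (norm_nonneg _).trans (hB D.base)
  have hbound : ∃ A : ℝ, 0 ≤ A ∧ ∀ (f : BlochHom.BlochSpace D) z, ‖ψ z * f (φ z)‖ ≤ A * ‖f‖ := by
    -- Boundedness of the operator needs only the estimate with `ε = 1`, together with uniform
    -- evaluation bounds on `K`.
    obtain ⟨K, hK, hKD, h⟩ := BlochHom.exists_isCompact_norm_mul_le hB hlim one_pos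
    obtain ⟨C, hC0, hC⟩ := BlochHom.BlochSpace.exists_norm_apply_le_of_isCompact hK hKD
    refine ⟨B * C + 1, by positivity, fun f z => ?_⟩
    refine (h f (C * ‖f‖) (fun w hw => ?_) z).trans (le_of_eq (by ring))
    rw [← BlochHom.extZero_apply f]
    exact hC w hw f
  obtain ⟨A, hA0, hA⟩ := hbound
  have hhol : ∀ f : BlochHom.BlochSpace D, BlochHom.Holo (fun z => ψ z * f (φ z)) := fun f =>
    hψ.mul_comp f.2.1 hφ
  let T₀ : BlochHom.BlochSpace D →ₗ[ℂ] (D.carrier →ᵇ ℂ) :=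
    { toFun := fun f => BoundedContinuousFunction.ofNormedAddCommGroup _ (hhol f).continuous _ (hA f)
      map_add' := fun f g => by
        ext z
        exact mul_add (ψ z) (f (φ z)) (g (φ z))
      map_smul' := fun c f => by
        ext z
        exact mul_left_comm (ψ z) c (f (φ z)) }
  let T : BlochHom.BlochSpace D →L[ℂ] (D.carrier →ᵇ ℂ) := T₀.mkContinuous A fun f =>
    BoundedContinuousFunction.norm_ofNormedAddCommGroup_le _ (by positivity) (hA f)
  have hTz : ∀ f z, T f z = ψ z * f (φ z) := fun _ _ => rfl
  have hT : IsCompactOperator T := by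
    refine BlochHom.isCompactOperator_of_forall_exists_totallyBounded T fun ε hε => ?_
    obtain ⟨K, hK, hKD, h⟩ := BlochHom.exists_isCompact_norm_mul_le hB hlim hε
    have : CompactSpace K := isCompact_iff_compactSpace.1 hK
    refine ⟨K →ᵇ ℂ, inferInstance, BlochHom.BlochSpace.restrictCompact hKD, B, hB0,
      BlochHom.BlochSpace.totallyBounded_restrictCompact hKD, fun f g => ?_⟩
    refine (BoundedContinuousFunction.norm_le (by positivity)).2 fun z => ?_
    rw [hTz]
    -- Here `M` is the distance between the restrictions of `f` and `g` to `K`.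
    refine h (f - g) _ (fun w hw => ?_) z
    rw [BlochHom.BlochSpace.toFun_sub_apply, ← dist_eq_norm]
    exact BoundedContinuousFunction.dist_coe_le_dist (f := BlochHom.BlochSpace.restrictCompact hKD f)
      (g := BlochHom.BlochSpace.restrictCompact hKD g) ⟨w, hw⟩
  have hmem : ∀ f, T f ∈ BlochHom.HInfty D := hhol
  -- Compactness was shown in the space of all bounded continuous functions; it passes to `HInfty D`
  -- because that subspace is closed.
  exact ⟨T.codRestrict (BlochHom.HInfty D) hmem, hTz, hT.codRestrict hmem
    (BlochHom.isClosed_HInfty D)⟩
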